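/- Let $n\ge 1$ and let $\mathfrak S_n$ be the set of permutations of $[n]=\{1,\dots,n\}$. For $\sigma\in\mathfrak S_n$ put $\mathsf{exc}\,\sigma=\#\{i\in[n]: i<\sigma(i)\}$ and $$\mathsf{cros}\,\sigma=\sum_{i=1}^n\#\{j\in[n]: j<i<\sigma(j)<\sigma(i)\ \text{or}\ \sigma(i)<\sigma(j)\le i<j\},$$ $$\mathsf{nest}\,\sigma=\sum_{i=1}^n\#\{j\in[n]: j<i<\sigma(i)<\sigma(j)\ \text{or}\ \sigma(j)<\sigma(i)\le i<j\}.$$ Let $\sigma^*$ be the permutation of $\{0,1,\dots,n\}$ with $\sigma^*(0)=n$ and $\sigma^*(i)=\sigma(i)-1$ for $1\le i\le n$, and put $\mathsf{cpk}^*\sigma=\#\{i\in[n-1]: (\sigma^*)^{-1}(i)<i>\sigma^*(i)\}$. Define the polynomials $$A_n(p,q,t)=\sum_{\sigma\in\mathfrak S_n}p^{\mathsf{nest}\,\sigma}q^{\mathsf{cros}\,\sigma}t^{\mathsf{exc}\,\sigma},\qquad P_n(p,q,x,t)=\sum_{\sigma\in\mathfrak S_n}p^{\mathsf{nest}\,\sigma}q^{\mathsf{cros}\,\sigma}x^{\mathsf{cpk}^*\sigma}t^{\mathsf{exc}\,\sigma}.$$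 Let $K$ be a field. Then: (1) For all $p,q,x,t\in K$ with $1+x\ne0$, $x+t\ne 0$ and $1+xt\neq0$, $$A_n(p,q,t)=\left(\frac{1+xt}{1+x}\right)^{n-1}P_n\!\left(p,q,\frac{(1+x)^2t}{(x+t)(1+xt)},\frac{x+t}{1+xt}\right).$$ (2) Suppose $K$ has characteristic different from $2$. Let $p,q,x,t\in K$ with $x\ne0$, $x\neq1$, $t\ne0$, let $s\in K$ be a square root of $(1+t)^2-4xt$, i.e. $s^2=(1+t)^2-4xt$, and put $$u=\frac{1+t^2-2xt-(1-t)s}{2(1-x)t},\qquad v=\frac{(1+t)^2-2xt-(1+t)s}{2xt}.$$ If $1+uv\neq 0$, then $$P_n(p,q,x,t)=\left(\frac{1+u}{1+uv}\right)^{n-1}A_n(p,q,v).$$ -/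

import Mathlib

/-!
Permutations of `[n] = {1, …, n}` are modelled by `Equiv.Perm (Fin n)`, the element `i : Fin n`
standing for the integer `i + 1`. This shift does not affect any of the comparisons below.
-/

namespace PermStat

/-- `exc σ = #{i : i < σ(i)}`. -/
def exc {n : ℕ} (σ : Equiv.Perm (Fin n)) : ℕ :=
  (Finset.univ.filter fun i : Fin n => i < σ i).card

/-- `cros_i σ = #{j : j < i < σ(j) < σ(i) or σ(i) < σ(j) ≤ i < j}`. -/
def crosAt {n : ℕ} (σ : Equiv.Perm (Fin n)) (i : Fin n) : ℕ :=
  (Finset.univ.filter fun j : Fin n =>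
    (j < i ∧ i < σ j ∧ σ j < σ i) ∨ (σ i < σ j ∧ σ j ≤ i ∧ i < j)).card

/-- `nest_i σ = #{j : j < i < σ(i) < σ(j) or σ(j) < σ(i) ≤ i < j}`. -/
def nestAt {n : ℕ} (σ : Equiv.Perm (Fin n)) (i : Fin n) : ℕ :=
  (Finset.univ.filter fun j : Fin n =>
    (j < i ∧ i < σ i ∧ σ i < σ j) ∨ (σ j < σ i ∧ σ i ≤ i ∧ i < j)).card

/-- `cros σ = ∑ i, cros_i σ`. -/
def cros {n : ℕ} (σ : Equiv.Perm (Fin n)) : ℕ := ∑ i, crosAt σ i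

/-- `nest σ = ∑ i, nest_i σ`. -/
def nest {n : ℕ} (σ : Equiv.Perm (Fin n)) : ℕ := ∑ i, nestAt σ i

/-- The star companion `σ*` of `σ`: the permutation of `{0, …, n}` with `σ*(0) = n` and
`σ*(i) = σ(i) - 1` for `1 ≤ i ≤ n`; see `starCompanion_zero` and `starCompanion_succ`. -/
def starCompanion {n : ℕ} (σ : Equiv.Perm (Fin n)) : Equiv.Perm (Fin (n + 1)) :=
  (finSuccEquiv n).trans ((Equiv.optionCongr σ).trans finSuccEquivLast.symm)

theorem starCompanion_zero {n : ℕ} (σ : Equiv.Perm (Fin n)) :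
    starCompanion σ 0 = Fin.last n := by
  simp [starCompanion]

theorem starCompanion_succ {n : ℕ} (σ : Equiv.Perm (Fin n)) (i : Fin n) :
    starCompanion σ i.succ = (σ i).castSucc := by
  simp [starCompanion]

/-- `cpk* σ = #{i ∈ [n - 1] : (σ*)⁻¹(i) < i > σ*(i)}`, the number of cyclic peaks of the star
companion in `[n - 1]`. -/
def cpkStar {n : ℕ} (σ : Equiv.Perm (Fin n)) : ℕ :=
  (Finset.univ.filter fun i : Fin (n + 1) =>
    (0 < (i : ℕ) ∧ (i : ℕ) < n) ∧ (starCompanion σ)⁻¹ i < i ∧ starCompanion σ i < i).card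

/-- The generating polynomial
`P^(stat_1, …, stat_m)(Ω; t_1, …, t_m) = ∑_{σ ∈ Ω} t_1 ^ stat_1 σ ⋯ t_m ^ stat_m σ`. -/
def genPoly {K : Type*} [CommSemiring K] {n m : ℕ} (stat : Fin m → Equiv.Perm (Fin n) → ℕ)
    (Ω : Finset (Equiv.Perm (Fin n))) (t : Fin m → K) : K :=
  ∑ σ ∈ Ω, ∏ k, t k ^ stat k σ

/-- `A_n(p, q, t) = ∑_{σ ∈ S_n} p ^ nest σ * q ^ cros σ * t ^ exc σ`. -/
def A {K : Type*} [CommSemiring K] (n : ℕ) (p q t : K) : K :=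
  ∑ σ : Equiv.Perm (Fin n), p ^ nest σ * q ^ cros σ * t ^ exc σ

end PermStat

/-! Fix the sets of excedance positions and of excedance values. The excedance part and the weak
non-excedance part of the permutation are then independent. When each is built by successive
choices, every `i` contributes a `(p, q)`-integer, whose argument is one plus the number of
excedance positions below `i` minus the number of excedance values up to `i` (`sum_excPos_excVal`).

Put `n = m + 1` and lower the values by one: positions and values become subsets `X`, `Y` of the
same `m`-element set. The weight involves only differences of counts, so it survives deleting `X ∩
Y` (`excWeight_sdiff`), while `exc` is `#X` and `cpk*` is `#(Y \ X)`. Summing over all possible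
common parts gives an expansion in `(x * t) ^ k * (1 + t) ^ (m - 2 * k)` whose coefficients are free
of `x` and `t` (`P_eq_sum_gamma`).

Hence scaling `1 + t` by `c` and `x * t` by `c ^ 2` multiplies the polynomial by `c ^ m`
(`P_eq_pow_mul_P`). As `A` is the case `x = 1`, both identities are changes of parameters. -/

namespace PermStat

open Finset

/-! ### Successive choices and `(p, q)`-integers -/

/-- The `(p, q)`-analogue `∑_{i < m} q ^ i * p ^ (m - 1 - i)` of the integer `m`. -/
def pqNat {K : Type*} [CommSemiring K] (p q : K) (m : ℕ) : K :=
  ∑ i ∈ range m, q ^ i * p ^ (m - 1 - i)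

theorem pqNat_succ {K : Type*} [CommSemiring K] (p q : K) (m : ℕ) :
    pqNat p q (m + 1) = q ^ m + p * pqNat p q m := by
  rw [pqNat, sum_range_succ, add_comm, pqNat, mul_sum]
  congr 1
  · simp
  · refine sum_congr rfl fun i hi => ?_
    have hm : m + 1 - 1 - i = (m - 1 - i) + 1 := by have := mem_range.1 hi; omega
    rw [hm, pow_succ]
    ring

/-- Summing over the rank of an element of a finite chain produces a `(p, q)`-integer. -/
theorem sum_rank_eq_pqNat {K β : Type*} [CommSemiring K] [LinearOrder β] (p q : K)
    (R : Finset β) :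
    ∑ b ∈ R, p ^ #{v ∈ R | b < v} * q ^ #{v ∈ R | v < b} = pqNat p q #R := by
  induction R using Finset.induction_on_max with
  | empty => simp [pqNat]
  | insert m R hm ih =>
    have hmem : m ∉ R := fun h => lt_irrefl _ (hm m h)
    rw [sum_insert hmem, card_insert_of_notMem hmem, pqNat_succ, ← ih, mul_sum]
    congr 1
    · have h1 : filter (fun v => m < v) (insert m R) = ∅ := by
        ext v; simp only [mem_filter, mem_insert, notMem_empty, iff_false]
        rintro ⟨rfl | h, h'⟩
        · exact lt_irrefl _ h'
        · exact lt_asymm h' (hm v h)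
      have h2 : filter (fun v => v < m) (insert m R) = R := by
        ext v; simp only [mem_filter, mem_insert]
        refine ⟨?_, fun h => ⟨Or.inr h, hm v h⟩⟩
        rintro ⟨rfl | h, h'⟩
        · exact absurd h' (lt_irrefl _)
        · exact h
      rw [h1, h2]; simp
    · refine sum_congr rfl fun b hb => ?_
      rw [filter_insert, filter_insert, if_pos (hm b hb), if_neg (lt_asymm (hm b hb)),
        card_insert_of_notMem (by simp [hmem]), pow_succ]
      ring

/-- The permutation with first value `b` whose other values are in the same relative order as
those of `g`. -/
def consPerm {k : ℕ} (b : Fin (k + 1)) (g : Equiv.Perm (Fin k)) : Equiv.Perm (Fin (k + 1)) :=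
  (finSuccEquiv k).trans ((Equiv.optionCongr g).trans (finSuccEquiv' b).symm)

@[simp] theorem consPerm_zero {k : ℕ} (b : Fin (k + 1)) (g : Equiv.Perm (Fin k)) :
    consPerm b g 0 = b := by
  simp [consPerm]

@[simp] theorem consPerm_succ {k : ℕ} (b : Fin (k + 1)) (g : Equiv.Perm (Fin k)) (i : Fin k) :
    consPerm b g i.succ = b.succAbove (g i) := by
  simp [consPerm]

theorem consPerm_bijective (k : ℕ) :
    Function.Bijective fun x : Fin (k + 1) × Equiv.Perm (Fin k) => consPerm x.1 x.2 := by
  rw [Fintype.bijective_iff_injective_and_card]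
  constructor
  · rintro ⟨b, g⟩ ⟨b', g'⟩ h
    have hb : b = b' := by simpa using DFunLike.congr_fun h 0
    subst hb
    have hg : g = g' := by
      ext1 i
      simpa using DFunLike.congr_fun h i.succ
    rw [hg]
  · simp [Fintype.card_perm, Nat.factorial_succ]

theorem card_filter_succ {k : ℕ} (P : Fin (k + 1) → Prop) [DecidablePred P] (h : ¬ P 0) :
    #{j | P j} = #{j : Fin k | P j.succ} := by
  rw [Fin.univ_succ, filter_cons_of_neg _ _ _ _ h, filter_map, card_map]
  rfl

theorem card_filter_succAbove {k : ℕ} (P : Fin (k + 1) → Prop) [DecidablePred P]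
    (b : Fin (k + 1)) :
    #{j | P j} = (if P b then 1 else 0) + #{j : Fin k | P (b.succAbove j)} := by
  rw [Fin.univ_succAbove k b, filter_cons]
  split_ifs <;> simp [filter_map, Function.comp_def, add_comm] <;> rfl

/-- The permutations `f` with `r i (f i)` for all `i`, where the sets of admissible values
increase with `i`, are determined by the successive ranks of `f i` among the admissible values
that are still unused. -/
theorem sum_perm_prod_rank {K : Type*} [CommSemiring K] (p q : K) {k : ℕ}
    (r : Fin k → Fin k → Prop) [DecidableRel r] (hr : ∀ i j v, i ≤ j → r i v → r j v) :
    ∑ f : Equiv.Perm (Fin k) with ∀ i, r i (f i),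
      ∏ i, (p ^ #{j | i < j ∧ r i (f j) ∧ f i < f j} *
        q ^ #{j | i < j ∧ r i (f j) ∧ f j < f i}) =
      ∏ i, pqNat p q (#{v | r i v} - #{j | j < i}) := by
  induction k with
  | zero => simp
  | succ k ih =>
    rw [sum_filter, ← (consPerm_bijective k).sum_comp, Fintype.sum_prod_type, Fin.prod_univ_succ]
    have h0 : pqNat p q (#{v | r 0 v} - #{j : Fin (k + 1) | j < 0}) =
        ∑ b with r 0 b, p ^ #{v | r 0 v ∧ b < v} * q ^ #{v | r 0 v ∧ v < b} := by
      simp only [Fin.not_lt_zero, filter_false, card_empty, Nat.sub_zero]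
      rw [← sum_rank_eq_pqNat]
      simp only [filter_filter]
    rw [h0, sum_mul, sum_filter]
    refine sum_congr rfl fun b _ => ?_
    by_cases hb : r 0 b
    swap
    · rw [if_neg hb]
      refine sum_eq_zero fun g _ => if_neg fun h => hb ?_
      simpa using h 0
    -- By monotonicity `b` is admissible at every later index, so using it up lowers both counts by
    -- one; truncated subtraction is unaffected.
    have hs : ∀ i : Fin k, #{v | r i.succ v} - #{j | j < i.succ} =
        #{v | r i.succ (b.succAbove v)} - #{j | j < i} := by
      intro i
      rw [card_filter_succAbove _ b, card_filter_succAbove (fun j => j < i.succ) 0,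
        if_pos (hr _ _ _ (Fin.zero_le _) hb), if_pos (Fin.succ_pos i)]
      simp [Nat.add_sub_add_left]
    simp only [hs]
    rw [if_pos hb, ← ih (fun i v => r i.succ (b.succAbove v))
      (fun i j v hij => hr _ _ _ (Fin.succ_le_succ_iff.2 hij)), sum_filter, mul_sum]
    refine sum_congr rfl fun g _ => ?_
    have hc : (∀ i, r i (consPerm b g i)) ↔ ∀ i : Fin k, r i.succ (b.succAbove (g i)) := by
      rw [Fin.forall_fin_succ]; simp [hb]
    simp only [hc]
    rw [mul_ite, mul_zero]
    refine if_congr Iff.rfl ?_ rfl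
    rw [Fin.prod_univ_succ]
    -- The later values are all values but `b`, and the strict comparisons with `b` fail at `b`
    -- itself.
    have hcard : ∀ P : Fin (k + 1) → Prop, ∀ [DecidablePred P], ¬ P b →
        #{j : Fin k | P (b.succAbove (g j))} = #{v | P v} := by
      intro P _ hP
      rw [card_filter_succAbove _ b, if_neg hP, zero_add]
      exact card_bijective g g.bijective (by simp)
    congr 1
    · rw [card_filter_succ _ (by simp), card_filter_succ _ (by simp)]
      simp only [consPerm_zero, consPerm_succ, Fin.succ_pos, true_and]
      rw [hcard (fun v => r 0 v ∧ b < v) (by simp), hcard (fun v => r 0 v ∧ v < b) (by simp)]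
    · refine prod_congr rfl fun i _ => ?_
      rw [card_filter_succ _ (by simp), card_filter_succ _ (by simp)]
      simp

/-- A version of `sum_perm_prod_rank` for bijections between two finite sets that are ordered by
enumerations `a` and `b`. -/
theorem sum_equiv_prod_rank {K α β : Type*} [CommSemiring K] [Fintype α] [Fintype β]
    [DecidableEq α] [DecidableEq β] (p q : K) {k : ℕ} (a : α ≃ Fin k) (b : β ≃ Fin k)
    (r : α → β → Prop) [∀ i v, Decidable (r i v)] (hr : ∀ i j v, a i ≤ a j → r i v → r j v) :
    ∑ f : α ≃ β with ∀ i, r i (f i),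
      ∏ i, (p ^ #{j | a i < a j ∧ r i (f j) ∧ b (f i) < b (f j)} *
        q ^ #{j | a i < a j ∧ r i (f j) ∧ b (f j) < b (f i)}) =
      ∏ i, pqNat p q (#{v | r i v} - #{j | a j < a i}) := by
  have key := sum_perm_prod_rank p q (fun i v => r (a.symm i) (b.symm v))
    (fun i j v hij => hr _ _ _ (by simpa using hij))
  have ha : ∀ (P : α → Prop) [DecidablePred P], #{j | P (a.symm j)} = #{j | P j} := by
    intro P _
    exact card_bijective a.symm a.symm.bijective (by simp)
  have hb : ∀ (P : β → Prop) [DecidablePred P], #{j | P (b.symm j)} = #{j | P j} := by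
    intro P _
    exact card_bijective b.symm b.symm.bijective (by simp)
  rw [← a.symm.prod_comp]
  rw [sum_filter] at key ⊢
  rw [← (a.equivCongr b).sum_comp] at key
  convert key using 1
  · refine sum_congr rfl fun f _ => if_congr ?_ ?_ rfl
    · rw [← a.symm.forall_congr_right]; simp
    · rw [← a.symm.prod_comp]
      refine prod_congr rfl fun i _ => ?_
      rw [← ha, ← ha]
      simp
  · refine prod_congr rfl fun i _ => ?_
    rw [← ha, ← hb]
    simp

theorem exists_strictMono_equiv_fin {α : Type*} [LinearOrder α] [Fintype α] {k : ℕ}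
    (h : Fintype.card α = k) : ∃ a : α ≃ Fin k, ∀ i j, a i < a j ↔ i < j :=
  ⟨(Fintype.orderIsoFinOfCardEq α h).symm.toEquiv, fun i j => by simp⟩

theorem exists_strictAnti_equiv_fin {α : Type*} [LinearOrder α] [Fintype α] {k : ℕ}
    (h : Fintype.card α = k) : ∃ a : α ≃ Fin k, ∀ i j, a i < a j ↔ j < i :=
  ⟨(Fintype.orderIsoFinOfCardEq α h).symm.toEquiv.trans Fin.revPerm, fun i j => by simp⟩

theorem card_filter_subtype {α : Type*} [Fintype α] (S P : α → Prop) [DecidablePred S]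
    [DecidablePred P] [Fintype {i // S i}] : #{j : {i // S i} | P j} = #{j | S j ∧ P j} := by
  rw [← card_map (Function.Embedding.subtype S)]
  congr 1
  ext j
  simp [and_comm]

/-! ### Permutations with prescribed excedance positions and values -/

section

variable {K : Type*} [CommSemiring K] {n : ℕ}

/-- The generating function of the excedance part of a permutation with excedance positions `E`
and excedance values `V`. -/
theorem sum_exc_part (p q : K) (E V : Finset (Fin n)) (h : #E = #V) :
    ∑ f : {i // i ∈ E} ≃ {v // v ∈ V} with ∀ i, i.1 < (f i).1,
      ∏ i, (p ^ #{j | j < i ∧ i.1 < (f j).1 ∧ f i < f j} *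
        q ^ #{j | j < i ∧ i.1 < (f j).1 ∧ f j < f i}) =
      ∏ i : {i // i ∈ E}, pqNat p q (#{j ∈ E | j < i.1} + 1 - #{v ∈ V | v ≤ i.1}) := by
  -- Positions are treated from the largest down, since the set of values above `i` grows as `i`
  -- decreases.
  obtain ⟨a, ha⟩ := exists_strictAnti_equiv_fin (α := {i // i ∈ E}) (k := #E) (by simp)
  obtain ⟨b, hb⟩ := exists_strictMono_equiv_fin (α := {i // i ∈ V}) (k := #E) (by simp [h])
  have key := sum_equiv_prod_rank p q a b (fun i v => i.1 < v.1) (by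
    intro i j v hij hv
    rw [← not_lt, ha, not_lt] at hij
    exact lt_of_le_of_lt hij hv)
  simp only [ha, hb] at key
  rw [key]
  refine prod_congr rfl fun i _ => ?_
  congr 1
  have e1 : #{v : {v // v ∈ V} | i.1 < v.1} = #{v ∈ V | ¬ v ≤ i.1} := by
    rw [card_filter_subtype (fun v => v ∈ V) (fun v => i.1 < v)]
    congr 1; ext v; simp
  have e2 : #{j : {j // j ∈ E} | i < j} = #{j ∈ E | ¬ j ≤ i.1} := by
    have := card_filter_subtype (fun v => v ∈ E) (fun v => i.1 < v)
    simp only [Subtype.coe_lt_coe] at this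
    rw [this]
    congr 1; ext v; simp
  have e3 : #{j ∈ E | j ≤ i.1} = #{j ∈ E | j < i.1} + 1 := by
    rw [← card_insert_of_notMem (a := i.1) (by simp)]
    congr 1; ext j
    simp only [mem_filter, mem_insert, le_iff_lt_or_eq]
    have := i.2
    aesop
  have e4 := card_filter_add_card_filter_not (s := V) (fun v => v ≤ i.1)
  have e5 := card_filter_add_card_filter_not (s := E) (fun v => v ≤ i.1)
  omega

/-- The generating function of the weak non-excedance part of a permutation with excedance
positions `E` and excedance values `V`. -/
theorem sum_nonexc_part (p q : K) (E V : Finset (Fin n)) (h : #E = #V) :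
    ∑ f : {i // ¬ i ∈ E} ≃ {v // ¬ v ∈ V} with ∀ i, (f i).1 ≤ i.1,
      ∏ i, (p ^ #{j | i < j ∧ (f j).1 ≤ i.1 ∧ f j < f i} *
        q ^ #{j | i < j ∧ (f j).1 ≤ i.1 ∧ f i < f j}) =
      ∏ i : {i // ¬ i ∈ E}, pqNat p q (#{j ∈ E | j < i.1} + 1 - #{v ∈ V | v ≤ i.1}) := by
  -- Here the values up to `i` grow with `i`, so positions are treated in increasing order; the
  -- values are reversed so that `p` still marks nestings.
  obtain ⟨a, ha⟩ := exists_strictMono_equiv_fin (α := {i // ¬ i ∈ E}) (k := n - #E)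
    (by simp [Fintype.card_subtype_compl])
  obtain ⟨b, hb⟩ := exists_strictAnti_equiv_fin (α := {i // ¬ i ∈ V}) (k := n - #E)
    (by simp [Fintype.card_subtype_compl, h])
  have key := sum_equiv_prod_rank p q a b (fun i v => v.1 ≤ i.1) (by
    intro i j v hij hv
    rw [← not_lt, ha, not_lt] at hij
    exact le_trans hv hij)
  simp only [ha, hb] at key
  rw [key]
  refine prod_congr rfl fun i _ => ?_
  congr 1
  have e1 : #{v : {v // ¬ v ∈ V} | v.1 ≤ i.1} = #{v ∈ Finset.Iic i.1 | ¬ v ∈ V} := by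
    rw [card_filter_subtype (fun v => ¬ v ∈ V) (fun v => v ≤ i.1)]
    congr 1; ext v; simp [and_comm]
  have e2 : #{j : {j // ¬ j ∈ E} | j < i} = #{j ∈ Finset.Iio i.1 | ¬ j ∈ E} := by
    have := card_filter_subtype (fun v => ¬ v ∈ E) (fun v => v < i.1)
    simp only [Subtype.coe_lt_coe] at this
    rw [this]
    congr 1; ext v; simp [and_comm]
  have e3 : #{v ∈ V | v ≤ i.1} = #{v ∈ Finset.Iic i.1 | v ∈ V} := by
    congr 1; ext v; simp [and_comm]
  have e6 : #{v ∈ E | v < i.1} = #{v ∈ Finset.Iio i.1 | v ∈ E} := by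
    congr 1; ext v; simp [and_comm]
  -- Complementing in the `i + 1` values up to `i` and the `i` positions below it yields the same
  -- argument as for excedances.
  have e4 := card_filter_add_card_filter_not (s := Finset.Iic i.1) (fun v => v ∈ V)
  have e5 := card_filter_add_card_filter_not (s := Finset.Iio i.1) (fun v => v ∈ E)
  rw [Fin.card_Iic] at e4
  rw [Fin.card_Iio] at e5
  omega

/-- The excedance positions of `σ`. -/
def excPos (σ : Equiv.Perm (Fin n)) : Finset (Fin n) := {i | i < σ i}

/-- The excedance values of `σ`. -/
def excVal (σ : Equiv.Perm (Fin n)) : Finset (Fin n) := {v | σ.symm v < v}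

theorem card_excPos_eq_card_excVal (σ : Equiv.Perm (Fin n)) : #(excPos σ) = #(excVal σ) :=
  card_bijective σ σ.bijective (by simp [excPos, excVal])

theorem pow_nest_mul_pow_cros (p q : K) (σ : Equiv.Perm (Fin n)) :
    p ^ nest σ * q ^ cros σ = ∏ i, (p ^ nestAt σ i * q ^ crosAt σ i) := by
  rw [prod_mul_distrib, prod_pow_eq_pow_sum, prod_pow_eq_pow_sum]; rfl

section

variable (E V : Finset (Fin n)) (f : {i // i ∈ E} ≃ {v // v ∈ V})
  (g : {i // ¬ i ∈ E} ≃ {v // ¬ v ∈ V})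

theorem subtypeCongr_of_mem (i : {i // i ∈ E}) : Equiv.subtypeCongr f g i = f i := by
  simp [Equiv.subtypeCongr]

theorem subtypeCongr_of_notMem (i : {i // ¬ i ∈ E}) : Equiv.subtypeCongr f g i = g i := by
  simp [Equiv.subtypeCongr]

theorem subtypeCongr_symm_of_mem (v : {v // v ∈ V}) :
    (Equiv.subtypeCongr f g).symm v = f.symm v := by
  rw [Equiv.symm_apply_eq, subtypeCongr_of_mem, Equiv.apply_symm_apply]

theorem subtypeCongr_symm_of_notMem (v : {v // ¬ v ∈ V}) :
    (Equiv.subtypeCongr f g).symm v = g.symm v := by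
  rw [Equiv.symm_apply_eq, subtypeCongr_of_notMem, Equiv.apply_symm_apply]

theorem lt_subtypeCongr_iff (hf : ∀ i, i.1 < (f i).1) (hg : ∀ i, (g i).1 ≤ i.1) (i : Fin n) :
    i < Equiv.subtypeCongr f g i ↔ i ∈ E := by
  by_cases hi : i ∈ E
  · simpa [hi, subtypeCongr_of_mem E V f g ⟨i, hi⟩] using hf ⟨i, hi⟩
  · simpa [hi, subtypeCongr_of_notMem E V f g ⟨i, hi⟩] using hg ⟨i, hi⟩

theorem excPos_subtypeCongr (hf : ∀ i, i.1 < (f i).1) (hg : ∀ i, (g i).1 ≤ i.1) :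
    excPos (Equiv.subtypeCongr f g) = E := by
  ext i
  simp [excPos, lt_subtypeCongr_iff E V f g hf hg]

theorem excVal_subtypeCongr (hf : ∀ i, i.1 < (f i).1) (hg : ∀ i, (g i).1 ≤ i.1) :
    excVal (Equiv.subtypeCongr f g) = V := by
  ext v
  simp only [excVal, mem_filter, mem_univ, true_and]
  by_cases hv : v ∈ V
  · simpa [hv, subtypeCongr_symm_of_mem E V f g ⟨v, hv⟩] using hf (f.symm ⟨v, hv⟩)
  · simpa [hv, subtypeCongr_symm_of_notMem E V f g ⟨v, hv⟩] using hg (g.symm ⟨v, hv⟩)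

/-- An excedance rules out the second alternative in the definition, and `j < i < σ j` makes `j` an
excedance too: the two parts of the permutation do not interact. -/
theorem nestAt_of_mem (hf : ∀ i, i.1 < (f i).1) (hg : ∀ i, (g i).1 ≤ i.1) (i : {i // i ∈ E}) :
    nestAt (Equiv.subtypeCongr f g) i =
      #{j | j < i ∧ i.1 < (f j).1 ∧ f i < f j} := by
  have hE := lt_subtypeCongr_iff E V f g hf hg
  have hi := (hE i).2 i.2
  have h := card_filter_subtype (fun j => j ∈ E) (fun j => j < i.1 ∧
    i.1 < Equiv.subtypeCongr f g j ∧ Equiv.subtypeCongr f g i < Equiv.subtypeCongr f g j)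
  simp only [subtypeCongr_of_mem, Subtype.coe_lt_coe] at h
  rw [h, nestAt]
  congr 1
  ext j
  simp only [mem_filter, mem_univ, true_and, ← hE, ← subtypeCongr_of_mem E V f g i]
  grind

theorem crosAt_of_mem (hf : ∀ i, i.1 < (f i).1) (hg : ∀ i, (g i).1 ≤ i.1) (i : {i // i ∈ E}) :
    crosAt (Equiv.subtypeCongr f g) i =
      #{j | j < i ∧ i.1 < (f j).1 ∧ f j < f i} := by
  have hE := lt_subtypeCongr_iff E V f g hf hg
  have hi := (hE i).2 i.2
  have h := card_filter_subtype (fun j => j ∈ E) (fun j => j < i.1 ∧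
    i.1 < Equiv.subtypeCongr f g j ∧ Equiv.subtypeCongr f g j < Equiv.subtypeCongr f g i)
  simp only [subtypeCongr_of_mem, Subtype.coe_lt_coe] at h
  rw [h, crosAt]
  congr 1
  ext j
  simp only [mem_filter, mem_univ, true_and, ← hE, ← subtypeCongr_of_mem E V f g i]
  grind

/-- Dually, only the second alternative survives, and `σ j ≤ i < j` keeps `j` outside `E`. -/
theorem nestAt_of_notMem (hf : ∀ i, i.1 < (f i).1) (hg : ∀ i, (g i).1 ≤ i.1)
    (i : {i // ¬ i ∈ E}) :
    nestAt (Equiv.subtypeCongr f g) i =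
      #{j | i < j ∧ (g j).1 ≤ i.1 ∧ g j < g i} := by
  have hE := lt_subtypeCongr_iff E V f g hf hg
  have hi := (hE i).not.2 i.2
  have h := card_filter_subtype (fun j => ¬ j ∈ E) (fun j => i.1 < j ∧
    Equiv.subtypeCongr f g j ≤ i.1 ∧ Equiv.subtypeCongr f g j < Equiv.subtypeCongr f g i)
  simp only [subtypeCongr_of_notMem, Subtype.coe_lt_coe] at h
  rw [h, nestAt]
  congr 1
  ext j
  simp only [mem_filter, mem_univ, true_and, ← hE, ← subtypeCongr_of_notMem E V f g i]
  grind

theorem crosAt_of_notMem (hf : ∀ i, i.1 < (f i).1) (hg : ∀ i, (g i).1 ≤ i.1)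
    (i : {i // ¬ i ∈ E}) :
    crosAt (Equiv.subtypeCongr f g) i =
      #{j | i < j ∧ (g j).1 ≤ i.1 ∧ g i < g j} := by
  have hE := lt_subtypeCongr_iff E V f g hf hg
  have hi := (hE i).not.2 i.2
  have h := card_filter_subtype (fun j => ¬ j ∈ E) (fun j => i.1 < j ∧
    Equiv.subtypeCongr f g j ≤ i.1 ∧ Equiv.subtypeCongr f g i < Equiv.subtypeCongr f g j)
  simp only [subtypeCongr_of_notMem, Subtype.coe_lt_coe] at h
  rw [h, crosAt]
  congr 1
  ext j
  simp only [mem_filter, mem_univ, true_and, ← hE, ← subtypeCongr_of_notMem E V f g i]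
  grind

end

/-- The generating function of the permutations with given excedance positions and values. -/
theorem sum_excPos_excVal (p q : K) (E V : Finset (Fin n)) :
    ∑ σ with excPos σ = E ∧ excVal σ = V, p ^ nest σ * q ^ cros σ =
      if #E = #V then ∏ i, pqNat p q (#{j ∈ E | j < i} + 1 - #{v ∈ V | v ≤ i}) else 0 := by
  split_ifs with h
  swap
  · rw [filter_false_of_mem, sum_empty]
    rintro σ - ⟨rfl, rfl⟩
    exact h (card_excPos_eq_card_excVal σ)
  rw [← Fintype.prod_subtype_mul_prod_subtype (fun i => i ∈ E)]
  have h1 := sum_exc_part p q E V h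
  have h2 := sum_nonexc_part p q E V h
  have h3 := congrArg₂ (· * ·) h1 h2
  rw [sum_mul_sum, ← sum_product'] at h3
  refine Eq.trans (Eq.symm ?_) (h3.trans (by congr!))
  refine sum_bij (fun x _ => Equiv.subtypeCongr x.1 x.2) ?_ ?_ ?_ ?_
  · rintro ⟨f, g⟩ hx
    simp only [mem_product, mem_filter, mem_univ, true_and] at hx ⊢
    exact ⟨excPos_subtypeCongr E V f g hx.1 hx.2, excVal_subtypeCongr E V f g hx.1 hx.2⟩
  · rintro ⟨f, g⟩ - ⟨f', g'⟩ - hfg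
    simp only at hfg
    rw [Prod.mk.injEq]
    constructor
    · ext i
      rw [← subtypeCongr_of_mem E V f g, hfg, subtypeCongr_of_mem]
    · ext i
      rw [← subtypeCongr_of_notMem E V f g, hfg, subtypeCongr_of_notMem]
  · intro σ hσ
    simp only [mem_filter, mem_univ, true_and] at hσ
    obtain ⟨rfl, rfl⟩ := hσ
    have hE : ∀ i, i ∈ excPos σ ↔ σ i ∈ excVal σ := by simp [excPos, excVal]
    refine ⟨(σ.subtypeEquiv hE, σ.subtypeEquiv fun i => not_congr (hE i)), ?_, ?_⟩
    · have hpos : ∀ i, i ∈ excPos σ ↔ i < σ i := by simp [excPos]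
      simp only [mem_product, mem_filter, mem_univ, true_and, Equiv.subtypeEquiv_apply]
      exact ⟨fun i => (hpos i).1 i.2, fun i => not_lt.1 ((hpos i).not.1 i.2)⟩
    · ext1 i
      by_cases hi : i ∈ excPos σ
      · exact subtypeCongr_of_mem _ _ _ _ ⟨i, hi⟩
      · exact subtypeCongr_of_notMem _ _ _ _ ⟨i, hi⟩
  · rintro ⟨f, g⟩ hx
    simp only [mem_product, mem_filter, mem_univ, true_and] at hx
    rw [pow_nest_mul_pow_cros, ← Fintype.prod_subtype_mul_prod_subtype (fun i => i ∈ E)]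
    simp only [nestAt_of_mem E V f g hx.1 hx.2, crosAt_of_mem E V f g hx.1 hx.2,
      nestAt_of_notMem E V f g hx.1 hx.2, crosAt_of_notMem E V f g hx.1 hx.2]
    congr!

end

/-! ### Cyclic peaks and the gamma expansion -/

section

variable {m : ℕ}

/-- The excedance positions of a permutation of `Fin (m + 1)`, as a subset of `Fin m`. -/
def excPosPred (σ : Equiv.Perm (Fin (m + 1))) : Finset (Fin m) := {a | a.castSucc ∈ excPos σ}

/-- The excedance values of a permutation of `Fin (m + 1)`, lowered by one. -/
def excValPred (σ : Equiv.Perm (Fin (m + 1))) : Finset (Fin m) := {a | a.succ ∈ excVal σ}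

/-- Nothing is lost in `Fin m`, as the last element is never an excedance position. -/
theorem excPosPred_map (σ : Equiv.Perm (Fin (m + 1))) :
    (excPosPred σ).map Fin.castSuccEmb = excPos σ := by
  ext i
  induction i using Fin.lastCases with
  | last => simp [excPos, Fin.le_last]
  | cast i => simp [excPosPred]

theorem excValPred_map (σ : Equiv.Perm (Fin (m + 1))) :
    (excValPred σ).map (Fin.succEmb m) = excVal σ := by
  ext i
  induction i using Fin.cases with
  | zero => simp [excVal]
  | succ i => simp [excValPred]

theorem exc_eq_card_excPosPred (σ : Equiv.Perm (Fin (m + 1))) : exc σ = #(excPosPred σ) := by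
  rw [← card_map Fin.castSuccEmb, excPosPred_map]
  rfl

theorem starCompanion_inv_castSucc {n : ℕ} (σ : Equiv.Perm (Fin n)) (i : Fin n) :
    (starCompanion σ)⁻¹ i.castSucc = (σ.symm i).succ := by
  rw [Equiv.Perm.inv_eq_iff_eq, starCompanion_succ, Equiv.apply_symm_apply]

/-- A peak at `a + 1` means `σ⁻¹ (a + 1) < a` and `σ a ≤ a`. The first inequality may be weakened to
`≤`, because equality would give `σ a = a + 1`. -/
theorem cpkStar_eq_card (σ : Equiv.Perm (Fin (m + 1))) :
    cpkStar σ = #(excValPred σ \ excPosPred σ) := by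
  rw [cpkStar, ← card_map ((Fin.succEmb m).trans Fin.castSuccEmb)]
  congr 1
  ext i
  induction i using Fin.lastCases with
  | last => simp
  | cast i =>
    induction i using Fin.cases with
    | zero => simp
    | succ a =>
      have h1 := starCompanion_inv_castSucc σ a.succ
      have h2 := starCompanion_succ σ a.castSucc
      rw [Fin.succ_castSucc] at h2
      have h3 : σ.symm a.succ = a.castSucc ↔ σ a.castSucc = a.succ := by
        rw [Equiv.symm_apply_eq, eq_comm]
      simp only [mem_filter, mem_univ, true_and, h1, h2, mem_map, mem_sdiff, excValPred,
        excPosPred, excPos, excVal]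
      simp only [Fin.ext_iff, Fin.lt_def, Function.Embedding.trans_apply, Fin.val_succ,
        Fin.val_castSucc, Fin.coe_succEmb, Fin.castSuccEmb_apply] at h3 ⊢
      constructor
      · intro h
        exact ⟨a, by omega, rfl⟩
      · rintro ⟨b, hb, hba⟩
        obtain rfl : b = a := by ext; omega
        have := b.2
        omega

variable {K : Type*} [CommSemiring K]

/-- The sum of `p ^ nest σ * q ^ cros σ` over the permutations with excedance positions `X` and
lowered excedance values `Y`. -/
def excWeight (p q : K) (X Y : Finset (Fin m)) : K :=
  if #X = #Y then
    ∏ i : Fin (m + 1), pqNat p q (#{a ∈ X | a.castSucc < i} + 1 - #{a ∈ Y | a.castSucc < i})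
  else 0

theorem sum_excPosPred_excValPred (p q : K) (X Y : Finset (Fin m)) :
    ∑ σ with excPosPred σ = X ∧ excValPred σ = Y, p ^ nest σ * q ^ cros σ =
      excWeight p q X Y := by
  have h := sum_excPos_excVal p q (X.map Fin.castSuccEmb) (Y.map (Fin.succEmb m))
  simp only [← excPosPred_map, ← excValPred_map, map_inj, card_map, filter_map] at h
  -- The lowering turns `≤` into `<`, so positions and values are counted under one condition.
  have hle : ∀ (a : Fin m) (i : Fin (m + 1)), a.succ ≤ i ↔ a.castSucc < i := fun a i => Iff.rfl
  rw [h, excWeight]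
  simp [Function.comp_def, hle]
  rfl

theorem card_filter_sdiff_add_inter {α : Type*} [DecidableEq α] (P : α → Prop) [DecidablePred P]
    (X Y : Finset α) : #{a ∈ X \ Y | P a} + #{a ∈ X ∩ Y | P a} = #{a ∈ X | P a} := by
  rw [← card_union_of_disjoint, ← filter_union, sdiff_union_inter]
  exact disjoint_filter_filter (disjoint_sdiff_inter X Y)

/-- A common element adds one to both counts or to neither, so it cancels. -/
theorem excWeight_sdiff (p q : K) (X Y : Finset (Fin m)) :
    excWeight p q (X \ Y) (Y \ X) = excWeight p q X Y := by
  have h : #(X \ Y) = #(Y \ X) ↔ #X = #Y := by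
    have h1 := card_sdiff_add_card_inter X Y
    have h2 := card_sdiff_add_card_inter Y X
    rw [inter_comm] at h2
    omega
  rw [excWeight, excWeight]
  refine if_congr h (prod_congr rfl fun i _ => ?_) rfl
  have h1 := card_filter_sdiff_add_inter (fun a => a.castSucc < i) X Y
  have h2 := card_filter_sdiff_add_inter (fun a => a.castSucc < i) Y X
  rw [inter_comm] at h2
  congr 1
  omega

/-- The joint generating function of `nest`, `cros`, `cpk*` and `exc`. -/
def P (m : ℕ) (p q x t : K) : K :=
  ∑ σ : Equiv.Perm (Fin (m + 1)), p ^ nest σ * q ^ cros σ * x ^ cpkStar σ * t ^ exc σ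

theorem P_eq_sum_excWeight (p q x t : K) :
    P m p q x t = ∑ Z : Finset (Fin m) × Finset (Fin m),
      excWeight p q Z.1 Z.2 * x ^ #(Z.2 \ Z.1) * t ^ #Z.1 := by
  rw [P, ← sum_fiberwise univ fun σ => (excPosPred σ, excValPred σ)]
  refine sum_congr rfl fun Z _ => ?_
  rw [← sum_excPosPred_excValPred, sum_mul, sum_mul]
  simp only [Prod.ext_iff]
  refine sum_congr rfl fun σ hσ => ?_
  obtain ⟨h1, h2⟩ := (mem_filter.1 hσ).2
  rw [exc_eq_card_excPosPred, cpkStar_eq_card, h1, h2]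

/-- Expansion in the basis `(x * t) ^ k * (1 + t) ^ (m - 2 * k)`. -/
theorem P_eq_sum_gamma (p q x t : K) :
    P m p q x t = ∑ Z : Finset (Fin m) × Finset (Fin m) with Disjoint Z.1 Z.2 ∧ #Z.1 = #Z.2,
      excWeight p q Z.1 Z.2 * ((x * t) ^ #Z.2 * (1 + t) ^ (m - 2 * #Z.2)) := by
  rw [P_eq_sum_excWeight, ← sum_fiberwise univ fun Z => (Z.1 \ Z.2, Z.2 \ Z.1), sum_filter]
  refine sum_congr rfl fun Z _ => ?_
  obtain ⟨X, Y⟩ := Z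
  by_cases hXY : Disjoint X Y
  swap
  · rw [if_neg (fun h => hXY h.1), filter_false_of_mem, sum_empty]
    rintro Z - hZ
    rw [Prod.mk.injEq] at hZ
    refine hXY ?_
    rw [← hZ.1, ← hZ.2]
    exact disjoint_sdiff_sdiff
  have h : ∀ Z : Finset (Fin m) × Finset (Fin m), Z ∈ univ.filter
      (fun Z : Finset (Fin m) × Finset (Fin m) => (Z.1 \ Z.2, Z.2 \ Z.1) = (X, Y)) →
      excWeight p q Z.1 Z.2 * x ^ #(Z.2 \ Z.1) * t ^ #Z.1 =
        excWeight p q X Y * x ^ #Y * t ^ #X * t ^ #(Z.1 ∩ Z.2) := by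
    rintro ⟨E, V⟩ hZ
    simp only [mem_filter, mem_univ, true_and, Prod.mk.injEq] at hZ
    obtain ⟨rfl, rfl⟩ := hZ
    rw [excWeight_sdiff, ← card_sdiff_add_card_inter E V, pow_add, mul_assoc _ (t ^ _) (t ^ _)]
  rw [sum_congr rfl h, ← mul_sum]
  split_ifs with hc
  swap
  · rw [excWeight, if_neg (fun h => hc ⟨hXY, h⟩)]
    simp
  -- A pair in this fibre is determined by its intersection, an arbitrary set avoiding `X ∪ Y`.
  have hs : ∑ Z : Finset (Fin m) × Finset (Fin m) with (Z.1 \ Z.2, Z.2 \ Z.1) = (X, Y),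
      t ^ #(Z.1 ∩ Z.2) = ∑ C ∈ (univ \ (X ∪ Y)).powerset, t ^ #C := by
    refine sum_nbij' (fun Z => Z.1 ∩ Z.2) (fun C => (X ∪ C, Y ∪ C)) ?_ ?_ ?_ ?_ ?_
    · rintro ⟨E, V⟩ hZ
      simp only [mem_filter, mem_univ, true_and, Prod.mk.injEq] at hZ
      obtain ⟨rfl, rfl⟩ := hZ
      rw [mem_powerset]
      intro a
      simp only [mem_sdiff, mem_union, mem_inter, mem_univ, true_and]
      tauto
    · intro C hC
      have hd := disjoint_left.1 hXY
      have hC' : ∀ a ∈ C, a ∉ X ∧ a ∉ Y := by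
        intro a ha
        simpa using mem_powerset.1 hC ha
      simp only [mem_filter, mem_univ, true_and, Prod.mk.injEq, Finset.ext_iff, mem_sdiff,
        mem_union]
      constructor <;> intro a <;> have := @hd a <;> have := hC' a <;> tauto
    · rintro ⟨E, V⟩ hZ
      simp only [mem_filter, mem_univ, true_and, Prod.mk.injEq] at hZ
      obtain ⟨rfl, rfl⟩ := hZ
      simp only [Prod.mk.injEq, sdiff_union_inter, true_and]
      rw [inter_comm, sdiff_union_inter]
    · intro C hC
      have hd := disjoint_left.1 hXY
      ext a
      have := @hd a
      simp only [mem_inter, mem_union]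
      tauto
    · intro Z _
      rfl
  rw [hs]
  have hp := sum_pow_mul_eq_add_pow t 1 (univ \ (X ∪ Y))
  simp only [one_pow, mul_one] at hp
  rw [hp, card_sdiff_of_subset (subset_univ _), card_union_of_disjoint hXY, card_univ,
    Fintype.card_fin, hc.2, ← two_mul, add_comm t 1, mul_pow]
  ring

/-- Makes the exponent `m - 2 * k` a genuine difference. -/
theorem two_mul_card_le {X Y : Finset (Fin m)} (h : Disjoint X Y) (hc : #X = #Y) :
    2 * #Y ≤ m := by
  have := card_le_univ (X ∪ Y)
  rw [card_union_of_disjoint h, Fintype.card_fin, hc] at this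
  omega

/-- Two parameter pairs whose gamma parameters agree up to the scaling `c` give proportional
polynomials. -/
theorem P_eq_pow_mul_P (p q : K) {x t x' t' c : K} (h : x * t = c ^ 2 * (x' * t'))
    (h' : 1 + t = c * (1 + t')) : P m p q x t = c ^ m * P m p q x' t' := by
  rw [P_eq_sum_gamma, P_eq_sum_gamma, mul_sum]
  refine sum_congr rfl fun Z hZ => ?_
  obtain ⟨hd, hc⟩ := (mem_filter.1 hZ).2
  obtain ⟨d, hm⟩ := Nat.exists_eq_add_of_le (two_mul_card_le hd hc)
  have hmd : m - 2 * #Z.2 = d := by omega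
  have hcm : c ^ m = (c ^ 2) ^ #Z.2 * c ^ d := by rw [← pow_mul, ← pow_add, ← hm]
  rw [h, h', hmd, hcm, mul_pow, mul_pow c]
  ring

theorem A_eq_P (p q t : K) : A (m + 1) p q t = P m p q 1 t := by
  simp [A, P]

theorem genPoly_eq_P (p q x t : K) :
    genPoly ![nest, cros, cpkStar, exc] (univ : Finset (Equiv.Perm (Fin (m + 1))))
      ![p, q, x, t] = P m p q x t := by
  simp [genPoly, P, Fin.prod_univ_four]

end

/-! ### Change of parameters -/

/-- The parameters `u` and `v` turn the gamma parameters of `(x, t)` into those of `(1, v)`. -/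
theorem exc_params {K : Type*} [Field K] {x t s u v : K} (h2 : (2 : K) ≠ 0) (hx : x ≠ 0)
    (hx1 : x ≠ 1) (ht : t ≠ 0) (hs : s ^ 2 = (1 + t) ^ 2 - 4 * x * t)
    (hu : u = (1 + t ^ 2 - 2 * x * t - (1 - t) * s) / (2 * (1 - x) * t))
    (hv : v = ((1 + t) ^ 2 - 2 * x * t - (1 + t) * s) / (2 * x * t)) :
    (1 + u) * (1 + v) = (1 + t) * (1 + u * v) ∧
      (1 + u) ^ 2 * v = x * t * (1 + u * v) ^ 2 := by
  have hx1' : 1 - x ≠ 0 := sub_ne_zero.2 hx1.symm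
  rw [eq_div_iff (by positivity)] at hu hv
  have h1 : (1 + u) * (1 + v) = (1 + t) * (1 + u * v) := by
    have h0 : (2 * x * t) * (2 * (1 - x) * t) ≠ 0 := by positivity
    apply mul_left_cancel₀ h0
    linear_combination (2 * x * t - t * (2 * x * t * v)) * hu +
      (2 * (1 - x) * t - t * (1 + t ^ 2 - 2 * x * t - (1 - t) * s)) * hv - t * (1 - t ^ 2) * hs
  refine ⟨h1, ?_⟩
  -- The quadratic equation of which `v` is a root: the invariant `x * t / (1 + t) ^ 2` equals `v /
  -- (1 + v) ^ 2`, cleared of denominators.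
  have hv2 : x * t * (1 + v) ^ 2 = (1 + t) ^ 2 * v := by
    have h0 : 4 * x * t ≠ 0 :=
      mul_ne_zero (mul_ne_zero (by convert mul_ne_zero h2 h2 using 1; norm_num) hx) ht
    apply mul_left_cancel₀ h0
    linear_combination (2 * x * t * v - ((1 + t) ^ 2 - 2 * x * t) - (1 + t) * s) * hv +
      (1 + t) ^ 2 * hs
  -- In general the square of `h1` combined with `hv2` gives the claim times `(1 + t) ^ 2`. At `t =
  -- -1` that factor vanishes, and `u` must be computed directly.
  by_cases ht1 : 1 + t = 0
  · obtain rfl : t = -1 := by linear_combination ht1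
    have hv1 : v = -1 := by
      have h0 : (1 + v) ^ 2 = 0 := by
        apply mul_left_cancel₀ (mul_ne_zero hx ht)
        linear_combination hv2
      linear_combination pow_eq_zero_iff two_ne_zero |>.1 h0
    subst hv1
    have hw : (1 - x) * u = s - 1 - x := by
      apply mul_left_cancel₀ h2
      linear_combination - hu
    apply mul_left_cancel₀ (pow_ne_zero 2 hx1')
    linear_combination (-(1 - x + (1 - x) * u + s - 2 * x) -
      x * (1 - x - (1 - x) * u + 2 - s)) * hw + (x - 1) * hs
  · apply mul_left_cancel₀ (pow_ne_zero 2 ht1)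
    linear_combination - (1 + u) ^ 2 * hv2 +
      x * t * ((1 + u) * (1 + v) + (1 + t) * (1 + u * v)) * h1

end PermStat

/-- Both identities hold in every field, wherever the displayed denominators do not vanish. In the
second one `s` is either square root of `(1 + t)² - 4xt`, so that the real or complex identity (any
branch of the root) and the identity of formal power series in `t` are special cases. -/
theorem mainTheorem1 {K : Type*} [Field K] (n : ℕ) (hn : 1 ≤ n) :
    (∀ p q x t : K, 1 + x ≠ 0 → x + t ≠ 0 → 1 + x * t ≠ 0 →
      PermStat.A n p q t =
        ((1 + x * t) / (1 + x)) ^ (n - 1) *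
          PermStat.genPoly
            ![PermStat.nest, PermStat.cros, PermStat.cpkStar, PermStat.exc] (Finset.univ : Finset (Equiv.Perm (Fin n)))
            ![p, q, (1 + x) ^ 2 * t / ((x + t) * (1 + x * t)), (x + t) / (1 + x * t)]) ∧
    (∀ p q x t s u v : K, (2 : K) ≠ 0 → x ≠ 0 → x ≠ 1 → t ≠ 0 →
      s ^ 2 = (1 + t) ^ 2 - 4 * x * t →
      u = (1 + t ^ 2 - 2 * x * t - (1 - t) * s) / (2 * (1 - x) * t) →
      v = ((1 + t) ^ 2 - 2 * x * t - (1 + t) * s) / (2 * x * t) →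
      1 + u * v ≠ 0 →
      PermStat.genPoly
          ![PermStat.nest, PermStat.cros, PermStat.cpkStar, PermStat.exc] (Finset.univ : Finset (Equiv.Perm (Fin n)))
          ![p, q, x, t] =
        ((1 + u) / (1 + u * v)) ^ (n - 1) * PermStat.A n p q v) := by
  obtain ⟨m, rfl⟩ : ∃ m, n = m + 1 := ⟨n - 1, by omega⟩
  constructor
  · intro p q x t h1 h2 h3
    rw [PermStat.A_eq_P, PermStat.genPoly_eq_P, Nat.add_sub_cancel]
    have h3' : 1 + t * x ≠ 0 := mul_comm x t ▸ h3
    -- The scaling is `c = (1 + x * t) / (1 + x)`; it works since `(x + t) + (1 + x * t) = (1 + x) *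
    -- (1 + t)`.
    apply PermStat.P_eq_pow_mul_P
    · field_simp
    · field_simp
      ring
  · intro p q x t s u v h2 hx hx1 ht hs hu hv huv
    obtain ⟨h, h'⟩ := PermStat.exc_params h2 hx hx1 ht hs hu hv
    rw [PermStat.A_eq_P, PermStat.genPoly_eq_P, Nat.add_sub_cancel]
    apply PermStat.P_eq_pow_mul_P
    · field_simp
      linear_combination -h'
    · field_simp
      linear_combination -h
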